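/- For $\kappa\in\mathbb R$ and $d\in\mathbb N$ let $M^d_\kappa$ be the model space of dimension $d$ and constant curvature $\kappa$: for $\kappa>0$ the unit sphere $S^d\subset\mathbb R^{d+1}$ with its angular distance multiplied by $1/\sqrt{\kappa}$; for $\kappa<0$ the hyperbolic space $\mathbb H^d=\{x\in\mathbb R^{d+1}:\ \langle x,x\rangle_{\mathrm M}=-1,\ x_{d+1}>0\}$, where $\langle x,y\rangle_{\mathrm M}=\sum_{i=1}^d x_iy_i-x_{d+1}y_{d+1}$, with its distance $\operatorname{arcosh}(-\langle x,y\rangle_{\mathrm M})$ multiplied by $1/\sqrt{-\kappa}$; and for $\kappa=0$ the Euclidean space $\mathbb R^d$. Let $r_\kappa$ be the convexity radius of $M^d_\kappa$, that is, $r_\kappa=\infty$ if $\kappa\le 0$ and $r_\kappa=\frac{\pi}{2\sqrt\kappa}$ if $\kappa>0$. Let $C\subseteq M^d_\kappa$ be nonempty, closed and convex; here convex means that for all $p,q\in C$ (with $d(p,q)<\pi/\sqrt\kappa$ if $\kappa>0$) the unique minimizing geodesic from $p$ to $q$ is contained in $C$. Let $x,y\in M^d_\kappa$ satisfy $\operatorname{dist}(x,C)\le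 r_\kappa$ and $\operatorname{dist}(y,C)\le r_\kappa$. Then the reflections $$\mathcal R_{C}\,x=\exp_{p}\bigl(-\log_{p}x\bigr),\qquad \mathcal R_{C}\,y=\exp_{q}\bigl(-\log_{q}y\bigr),$$ where $p$ and $q$ are points of $C$ nearest to $x$ and $y$, respectively, are well defined (such nearest points exist, and $\mathcal R_C\,x$, $\mathcal R_C\,y$ do not depend on their choice), and $$d\bigl(\mathcal R_{C}\,x,\mathcal R_{C}\,y\bigr)\le d(x,y).$$ -/

import Mathlib

noncomputable section

open scoped ENNReal

namespace ModelSpace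

/-- The ambient vector space `ℝ^{d+1}`, written as `ℝ^d × ℝ` to single out the last coordinate.
Only its vector space structure is used. -/
abbrev Ambient (d : ℕ) : Type := EuclideanSpace ℝ (Fin d) × ℝ

/-- The symmetric bilinear form on `ℝ^{d+1}` which induces the Riemannian metric:
the Euclidean inner product if `0 ≤ κ`,
the Minkowski form `x₁ y₁ + ⋯ + x_d y_d - x_{d+1} y_{d+1}` if `κ < 0`. -/
def form {d : ℕ} (κ : ℝ) (x y : Ambient d) : ℝ :=
  inner ℝ x.1 y.1 + (if κ < 0 then -1 else 1) * (x.2 * y.2)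

/-- The underlying set: the unit sphere if `0 < κ`, the upper sheet of the unit
hyperboloid if `κ < 0`, and `ℝ^d = ℝ^d × {0}` if `κ = 0`. -/
def IsPoint {d : ℕ} (κ : ℝ) (x : Ambient d) : Prop :=
  if 0 < κ then form κ x x = 1
  else if κ < 0 then form κ x x = -1 ∧ 0 < x.2
  else x.2 = 0

end ModelSpace

/-- The model space of dimension `d` and constant curvature `κ`
(its metric is defined below). -/
def ModelSpace (κ : ℝ) (d : ℕ) : Type := {x : ModelSpace.Ambient d // ModelSpace.IsPoint κ x}

namespace ModelSpace

variable {κ : ℝ} {d : ℕ}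

theorem form_comm (κ : ℝ) (x y : Ambient d) : form κ x y = form κ y x := by
  simp only [form, real_inner_comm, mul_comm]

theorem form_add_left (κ : ℝ) (x y z : Ambient d) :
    form κ (x + y) z = form κ x z + form κ y z := by
  simp only [form, Prod.fst_add, Prod.snd_add, inner_add_left]; ring

theorem form_smul_left (κ : ℝ) (a : ℝ) (x z : Ambient d) :
    form κ (a • x) z = a * form κ x z := by
  simp only [form, Prod.smul_fst, Prod.smul_snd, real_inner_smul_left, smul_eq_mul]; ring

theorem form_add_right (κ : ℝ) (x y z : Ambient d) :
    form κ x (y + z) = form κ x y + form κ x z := by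
  rw [form_comm, form_add_left, form_comm κ y, form_comm κ z]

theorem form_smul_right (κ : ℝ) (a : ℝ) (x z : Ambient d) :
    form κ x (a • z) = a * form κ x z := by
  rw [form_comm, form_smul_left, form_comm]

theorem form_sub_left (κ : ℝ) (x y z : Ambient d) :
    form κ (x - y) z = form κ x z - form κ y z := by
  have h : x - y = x + (-1 : ℝ) • y := by rw [neg_one_smul]; exact sub_eq_add_neg x y
  rw [h, form_add_left, form_smul_left]; ring

theorem form_sub_right (κ : ℝ) (x y z : Ambient d) :
    form κ x (y - z) = form κ x y - form κ x z := by
  rw [form_comm, form_sub_left, form_comm κ y, form_comm κ z]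

theorem form_self_of_pos (hκ : 0 < κ) (p : ModelSpace κ d) : form κ p.1 p.1 = 1 := by
  have h := p.2
  rwa [IsPoint, if_pos hκ] at h

theorem form_self_of_neg (hκ : κ < 0) (p : ModelSpace κ d) : form κ p.1 p.1 = -1 := by
  have h := p.2
  rw [IsPoint, if_neg hκ.le.not_gt, if_pos hκ] at h
  exact h.1

theorem snd_pos_of_neg (hκ : κ < 0) (p : ModelSpace κ d) : 0 < p.1.2 := by
  have h := p.2
  rw [IsPoint, if_neg hκ.le.not_gt, if_pos hκ] at h
  exact h.2

/-- The distance: the angular distance on the unit sphere multiplied by `1 / √κ` if `0 < κ`, the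
hyperbolic distance multiplied by `1 / √(-κ)` if `κ < 0`, the Euclidean distance if `κ = 0`. -/
def modelDist (x y : ModelSpace κ d) : ℝ :=
  if 0 < κ then 1 / √κ * Real.arccos (form κ x.1 y.1)
  else if κ < 0 then 1 / √(-κ) * Real.arcosh (-form κ x.1 y.1)
  else dist x.1.1 y.1.1

/-- A vector that is orthogonal to a point of the hyperboloid is spacelike. -/
theorem form_self_nonneg_of_neg (hκ : κ < 0) (p : ModelSpace κ d) {v : Ambient d}
    (hv : form κ p.1 v = 0) : 0 ≤ form κ v v ∧ (form κ v v = 0 → v = 0) := by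
  have hp := form_self_of_neg hκ p
  have ht := snd_pos_of_neg hκ p
  simp only [form, if_pos hκ, real_inner_self_eq_norm_sq] at hp hv ⊢
  have hcs := abs_real_inner_le_norm p.1.1 v.1
  have hin : inner ℝ p.1.1 v.1 = p.1.2 * v.2 := by linarith
  rw [hin] at hcs
  have h1 : (p.1.2 * v.2) ^ 2 ≤ (‖p.1.1‖ * ‖v.1‖) ^ 2 := by
    rw [← sq_abs (p.1.2 * v.2)]
    exact pow_le_pow_left₀ (abs_nonneg _) hcs 2
  have hpp : p.1.2 ^ 2 = ‖p.1.1‖ ^ 2 + 1 := by nlinarith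
  have h2 : ‖p.1.1‖ ^ 2 * v.2 ^ 2 + v.2 ^ 2 ≤ ‖p.1.1‖ ^ 2 * ‖v.1‖ ^ 2 := by
    nlinarith
  have h3 : v.2 ^ 2 ≤ ‖v.1‖ ^ 2 := by
    by_contra hlt
    push Not at hlt
    nlinarith [mul_le_mul_of_nonneg_left hlt.le (sq_nonneg ‖p.1.1‖), sq_nonneg v.2,
      sq_nonneg ‖v.1‖]
  refine ⟨by nlinarith, fun h0 => ?_⟩
  have h4 : v.2 ^ 2 = ‖v.1‖ ^ 2 := by nlinarith
  have h5 : v.2 ^ 2 = 0 := by rw [← h4] at h2; nlinarith [sq_nonneg v.2]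
  have h6 : ‖v.1‖ ^ 2 = 0 := by rw [← h4, h5]
  exact Prod.ext (norm_eq_zero.mp (pow_eq_zero_iff two_ne_zero |>.mp h6))
    (pow_eq_zero_iff two_ne_zero |>.mp h5)

/-- The Cauchy–Schwarz inequality on the tangent space at a point of the hyperboloid. -/
theorem form_sq_le_of_neg (hκ : κ < 0) (p : ModelSpace κ d) {v w : Ambient d}
    (hv : form κ p.1 v = 0) (hw : form κ p.1 w = 0) :
    form κ v w ^ 2 ≤ form κ v v * form κ w w := by
  obtain ⟨hw0, hwz⟩ := form_self_nonneg_of_neg hκ p hw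
  rcases hw0.eq_or_lt with h | h
  · have : w = 0 := hwz h.symm
    subst this
    simp [form]
  · have hu : form κ p.1 (form κ w w • v - form κ v w • w) = 0 := by
      rw [form_sub_right, form_smul_right, form_smul_right, hv, hw]; ring
    have := (form_self_nonneg_of_neg hκ p hu).1
    simp only [form_sub_left, form_sub_right, form_smul_left, form_smul_right,
      form_comm κ w v] at this
    have h2 : 0 ≤ form κ w w * (form κ v v * form κ w w - form κ v w ^ 2) := by nlinarith
    have := nonneg_of_mul_nonneg_right h2 h
    linarith

theorem one_le_neg_form_of_neg (hκ : κ < 0) (x y : ModelSpace κ d) :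
    1 ≤ -form κ x.1 y.1 := by
  have hx := form_self_of_neg hκ x
  have hy := form_self_of_neg hκ y
  have hxt := snd_pos_of_neg hκ x
  have hyt := snd_pos_of_neg hκ y
  simp only [form, if_pos hκ, real_inner_self_eq_norm_sq] at hx hy ⊢
  have hcs := real_inner_le_norm x.1.1 y.1.1
  have h : (1 + ‖x.1.1‖ * ‖y.1.1‖) ^ 2 ≤ (x.1.2 * y.1.2) ^ 2 := by
    rw [mul_pow, show x.1.2 ^ 2 = ‖x.1.1‖ ^ 2 + 1 by nlinarith,
      show y.1.2 ^ 2 = ‖y.1.1‖ ^ 2 + 1 by nlinarith]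
    nlinarith [sq_nonneg (‖x.1.1‖ - ‖y.1.1‖)]
  have := abs_le_of_sq_le_sq h (by positivity)
  have := le_abs_self (1 + ‖x.1.1‖ * ‖y.1.1‖)
  linarith

theorem arcosh_triangle_of_neg (hκ : κ < 0) (x y z : ModelSpace κ d) :
    Real.arcosh (-form κ x.1 z.1) ≤
      Real.arcosh (-form κ x.1 y.1) + Real.arcosh (-form κ y.1 z.1) := by
  have hx := form_self_of_neg hκ x
  have hy := form_self_of_neg hκ y
  have hz := form_self_of_neg hκ z
  have ha := one_le_neg_form_of_neg hκ x y
  have hb := one_le_neg_form_of_neg hκ y z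
  have hc := one_le_neg_form_of_neg hκ x z
  have hyx := form_comm κ y.1 x.1
  have hzy := form_comm κ z.1 y.1
  set a := form κ x.1 y.1 with hadef
  set b := form κ y.1 z.1 with hbdef
  set c := form κ x.1 z.1 with hcdef
  have hv : form κ y.1 (x.1 + a • y.1) = 0 := by
    rw [form_add_right, form_smul_right, hy, hyx]; ring
  have hw : form κ y.1 (z.1 + b • y.1) = 0 := by
    rw [form_add_right, form_smul_right, hy, ← hbdef]; ring
  have key := form_sq_le_of_neg hκ y hv hw
  simp only [form_add_left, form_add_right, form_smul_left, form_smul_right, hx, hy, hz, hyx, hzy,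
    ← hadef, ← hbdef, ← hcdef] at key
  have key2 : (c + a * b) ^ 2 ≤ ((-a) ^ 2 - 1) * ((-b) ^ 2 - 1) := by
    refine le_trans (le_of_eq ?_) (key.trans (le_of_eq ?_)) <;> ring
  have hle : -c ≤ (-a) * (-b) + √((-a) ^ 2 - 1) * √((-b) ^ 2 - 1) := by
    have h1 := Real.abs_le_sqrt key2
    rw [Real.sqrt_mul (by nlinarith)] at h1
    have h2 := neg_abs_le (c + a * b)
    nlinarith
  have hA := Real.arcosh_nonneg ha
  have hB := Real.arcosh_nonneg hb
  rw [← Real.arcosh_cosh (add_nonneg hA hB), Real.cosh_add, Real.cosh_arcosh ha,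
    Real.cosh_arcosh hb, Real.sinh_arcosh ha, Real.sinh_arcosh hb]
  refine (Real.arcosh_le_arcosh (by linarith) ?_).mpr hle
  have : 0 ≤ √((-a) ^ 2 - 1) * √((-b) ^ 2 - 1) := by positivity
  nlinarith

theorem arccos_form_eq_angle (hκ : 0 < κ) (x y : ModelSpace κ d) :
    Real.arccos (form κ x.1 y.1) =
      InnerProductGeometry.angle (WithLp.toLp 2 x.1) (WithLp.toLp 2 y.1) := by
  have key : ∀ u v : Ambient d,
      inner ℝ (WithLp.toLp 2 u) (WithLp.toLp 2 v) = form κ u v := by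
    intro u v
    rw [WithLp.prod_inner_apply, form, if_neg hκ.le.not_gt]
    simp [mul_comm]
  have hn : ∀ u : ModelSpace κ d, ‖WithLp.toLp 2 u.1‖ = 1 := by
    intro u
    rw [norm_eq_sqrt_real_inner, key, form_self_of_pos hκ, Real.sqrt_one]
  rw [InnerProductGeometry.angle, key, hn, hn]
  simp

theorem eq_of_form_eq_one (hκ : 0 < κ) (x y : ModelSpace κ d) (h : 1 ≤ form κ x.1 y.1) :
    x = y := by
  have hx := form_self_of_pos hκ x
  have hy := form_self_of_pos hκ y
  have hd : form κ (x.1 - y.1) (x.1 - y.1) ≤ 0 := by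
    simp only [form_sub_left, form_sub_right, hx, hy, form_comm κ y.1 x.1]
    linarith
  rw [form, if_neg hκ.le.not_gt, real_inner_self_eq_norm_sq] at hd
  have h1 : ‖(x.1 - y.1).1‖ ^ 2 = 0 := by
    nlinarith [sq_nonneg ‖(x.1 - y.1).1‖, mul_self_nonneg (x.1 - y.1).2]
  have h2 : (x.1 - y.1).2 ^ 2 = 0 := by
    nlinarith [sq_nonneg ‖(x.1 - y.1).1‖, mul_self_nonneg (x.1 - y.1).2]
  refine Subtype.ext (sub_eq_zero.mp (Prod.ext ?_ ?_))
  · exact norm_eq_zero.mp (pow_eq_zero_iff two_ne_zero |>.mp h1)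
  · exact pow_eq_zero_iff two_ne_zero |>.mp h2

theorem eq_of_neg_form_eq_one (hκ : κ < 0) (x y : ModelSpace κ d)
    (h : -form κ x.1 y.1 = 1) : x = y := by
  have hx := form_self_of_neg hκ x
  have hy := form_self_of_neg hκ y
  have hxy : form κ x.1 y.1 = -1 := by linarith
  have ho : form κ x.1 (y.1 - x.1) = 0 := by rw [form_sub_right, hx, hxy]; ring
  have hd : form κ (y.1 - x.1) (y.1 - x.1) = 0 := by
    simp only [form_sub_left, form_sub_right, hx, hy, form_comm κ y.1 x.1, hxy]; ring
  exact (Subtype.ext (sub_eq_zero.mp ((form_self_nonneg_of_neg hκ x ho).2 hd))).symm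

instance : MetricSpace (ModelSpace κ d) where
  dist := modelDist
  dist_self x := by
    unfold modelDist
    split_ifs with h1 h2
    · rw [form_self_of_pos h1]; simp
    · rw [form_self_of_neg h2]; simp
    · simp
  dist_comm x y := by
    simp only [modelDist, form_comm κ x.1 y.1, dist_comm x.1.1 y.1.1]
  dist_triangle x y z := by
    unfold modelDist
    split_ifs with h1 h2
    · rw [← mul_add]
      refine mul_le_mul_of_nonneg_left ?_ (by positivity)
      simp only [arccos_form_eq_angle h1]
      exact InnerProductGeometry.angle_le_angle_add_angle _ _ _
    · rw [← mul_add]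
      exact mul_le_mul_of_nonneg_left (arcosh_triangle_of_neg h2 x y z) (by positivity)
    · exact dist_triangle _ _ _
  eq_of_dist_eq_zero {x y} h := by
    change modelDist x y = 0 at h
    unfold modelDist at h
    split_ifs at h with h1 h2
    · have hs : 1 / √κ ≠ 0 := by positivity
      have h3 := (mul_eq_zero.mp h).resolve_left hs
      exact eq_of_form_eq_one h1 x y (Real.arccos_eq_zero.mp h3)
    · have hs : 1 / √(-κ) ≠ 0 := by
        have : 0 < -κ := by linarith
        positivity
      have h3 := (mul_eq_zero.mp h).resolve_left hs
      exact eq_of_neg_form_eq_one h2 x y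
        ((Real.arcosh_eq_zero_iff (one_le_neg_form_of_neg h2 x y)).mp h3)
    · have hx := x.2
      have hy := y.2
      rw [IsPoint, if_neg h1, if_neg h2] at hx hy
      exact Subtype.ext (Prod.ext (dist_eq_zero.mp h) (hx.trans hy.symm))

/-- The tangent space at `p`, as a linear subspace of `ℝ^{d+1}`. -/
def tangentSpace (p : ModelSpace κ d) : Submodule ℝ (Ambient d) where
  carrier := {v | if κ = 0 then v.2 = 0 else form κ p.1 v = 0}
  add_mem' {v w} hv hw := by
    simp only [Set.mem_ofPred_eq] at hv hw ⊢
    split_ifs at hv hw ⊢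
    · simp [hv, hw]
    · rw [form_add_right, hv, hw, add_zero]
  zero_mem' := by simp [form]
  smul_mem' a v hv := by
    simp only [Set.mem_ofPred_eq] at hv ⊢
    split_ifs at hv ⊢
    · simp [hv]
    · rw [form_smul_right, hv, mul_zero]

theorem form_of_mem_tangentSpace (hκ : κ ≠ 0) (p : ModelSpace κ d) (v : tangentSpace p) :
    form κ p.1 v.1 = 0 := by
  have h := v.2
  change (if κ = 0 then v.1.2 = 0 else form κ p.1 v.1 = 0) at h
  rwa [if_neg hκ] at h

/-- The length `√⟨v, v⟩` of a tangent vector with respect to the Riemannian metric of the unit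
sphere, hyperbolic space or Euclidean space (not rescaled). -/
def tangentNorm {p : ModelSpace κ d} (v : tangentSpace p) : ℝ := √(form κ v.1 v.1)

/-- The exponential map of the unit sphere, hyperbolic space or Euclidean space, as a map to
`ℝ^{d+1}`. Multiplying the distance by a constant does not change the exponential map.
For `v = 0` the convention `sin 0 / 0 = 0` gives `exp_p 0 = p`. -/
def expAmbient (p : ModelSpace κ d) (v : tangentSpace p) : Ambient d :=
  if 0 < κ then
    Real.cos (tangentNorm v) • p.1 + (Real.sin (tangentNorm v) / tangentNorm v) • v.1
  else if κ < 0 then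
    Real.cosh (tangentNorm v) • p.1 + (Real.sinh (tangentNorm v) / tangentNorm v) • v.1
  else p.1 + v.1

theorem isPoint_expAmbient (p : ModelSpace κ d) (v : tangentSpace p) :
    IsPoint κ (expAmbient p v) := by
  unfold IsPoint expAmbient
  split_ifs with h1 h2
  · have ho := form_of_mem_tangentSpace h1.ne' p v
    have hp := form_self_of_pos h1 p
    have hv0 : 0 ≤ form κ v.1 v.1 := by
      rw [form, if_neg h1.le.not_gt, real_inner_self_eq_norm_sq, one_mul]
      exact add_nonneg (sq_nonneg _) (mul_self_nonneg _)
    have hn : form κ v.1 v.1 = tangentNorm v ^ 2 := (Real.sq_sqrt hv0).symm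
    simp only [form_add_left, form_add_right, form_smul_left, form_smul_right, ho, hp, hn,
      form_comm κ v.1 p.1]
    rcases eq_or_ne (tangentNorm v) 0 with h0 | h0
    · simp [h0]
    · have := Real.sin_sq_add_cos_sq (tangentNorm v)
      field_simp
      linear_combination (tangentNorm v) * this
  · have ho := form_of_mem_tangentSpace h2.ne p v
    have hp := form_self_of_neg h2 p
    have ht := snd_pos_of_neg h2 p
    have hv0 := (form_self_nonneg_of_neg h2 p ho).1
    have hn : form κ v.1 v.1 = tangentNorm v ^ 2 := (Real.sq_sqrt hv0).symm
    set q : Ambient d :=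
      Real.cosh (tangentNorm v) • p.1 + (Real.sinh (tangentNorm v) / tangentNorm v) • v.1 with hq
    have hqq : form κ q q = -1 := by
      simp only [hq, form_add_left, form_add_right, form_smul_left, form_smul_right, ho, hp, hn,
        form_comm κ v.1 p.1]
      rcases eq_or_ne (tangentNorm v) 0 with h0 | h0
      · simp [h0]
      · have := Real.cosh_sq (tangentNorm v)
        field_simp
        linear_combination (-tangentNorm v) * this
    refine ⟨hqq, ?_⟩
    have hpq : form κ p.1 q = -Real.cosh (tangentNorm v) := by
      rw [hq, form_add_right, form_smul_right, form_smul_right, ho, hp]; ring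
    have hc := Real.cosh_pos (tangentNorm v)
    clear_value q
    simp only [form, if_pos h2, real_inner_self_eq_norm_sq] at hqq hpq hp
    have hcs := abs_real_inner_le_norm p.1.1 q.1
    have hcs' := neg_abs_le (inner ℝ p.1.1 q.1)
    by_contra hneg
    push Not at hneg
    have h3 : ‖p.1.1‖ < p.1.2 := by
      refine lt_of_pow_lt_pow_left₀ 2 ht.le ?_
      nlinarith
    have h4 : ‖q.1‖ ≤ -q.2 := by
      exact le_of_sq_le_sq (by nlinarith) (by linarith)
    nlinarith [mul_le_mul h3.le h4 (norm_nonneg _) ht.le]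
  · have hp := p.2
    rw [IsPoint, if_neg h1, if_neg h2] at hp
    have hv := v.2
    change (if κ = 0 then v.1.2 = 0 else form κ p.1 v.1 = 0) at hv
    rw [if_pos (le_antisymm (not_lt.mp h1) (not_lt.mp h2))] at hv
    simp [hp, hv]

/-- The exponential map `exp_p`. -/
def exp (p : ModelSpace κ d) (v : tangentSpace p) : ModelSpace κ d :=
  ⟨expAmbient p v, isPoint_expAmbient p v⟩

/-- The logarithmic map, as a map to `ℝ^{d+1}`; see `log`. -/
def logAmbient (p x : ModelSpace κ d) : Ambient d :=
  if 0 < κ then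
    (Real.arccos (form κ p.1 x.1) / √(1 - form κ p.1 x.1 ^ 2)) • (x.1 - form κ p.1 x.1 • p.1)
  else if κ < 0 then
    (Real.arcosh (-form κ p.1 x.1) / √(form κ p.1 x.1 ^ 2 - 1)) • (x.1 + form κ p.1 x.1 • p.1)
  else x.1 - p.1

theorem logAmbient_mem (p x : ModelSpace κ d) : logAmbient p x ∈ tangentSpace p := by
  change (if κ = 0 then (logAmbient p x).2 = 0 else form κ p.1 (logAmbient p x) = 0)
  unfold logAmbient
  split_ifs with h0 h1 h2 h1 h2
  · exact absurd h0 h1.ne'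
  · exact absurd h0 h2.ne
  · have hp := p.2
    have hx := x.2
    rw [IsPoint, if_neg h1, if_neg h2] at hp hx
    simp [hp, hx]
  · rw [form_smul_right, form_sub_right, form_smul_right, form_self_of_pos h1]; ring
  · rw [form_smul_right, form_add_right, form_smul_right, form_self_of_neg h2]; ring
  · exact absurd (le_antisymm (not_lt.mp h1) (not_lt.mp h2)) h0

/-- The logarithmic map `log_p`, the inverse of `exp_p`: `log_p x` is the shortest tangent vector
with `exp_p (log_p x) = x`. It is meaningful unless `0 < κ` and `x` is the antipode of `p`, which is
at distance `π / √κ` from `p`; there the formula returns the value `0`. -/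
def log (p x : ModelSpace κ d) : tangentSpace p := ⟨logAmbient p x, logAmbient_mem p x⟩

/-- The minimizing geodesic `γ : [0, 1] → M` from `p` to `q`, `γ t = exp_p (t log_p q)`
(for points `p` and `q` that are not antipodal). -/
def geodesic (p q : ModelSpace κ d) (t : ℝ) : ModelSpace κ d := exp p (t • log p q)

/-- `C` is convex: with any two points it contains the minimizing geodesic between them.
If `0 < κ`, this is required only of points that are not antipodal, since antipodal points are
joined by many minimizing geodesics. This is the weakest convention: a set that contains, for any
two of its points, some (or every) minimizing geodesic between them satisfies it. -/
def IsConvex (C : Set (ModelSpace κ d)) : Prop :=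
  ∀ p ∈ C, ∀ q ∈ C, (0 < κ → dist p q < Real.pi / √κ) →
    ∀ t ∈ Set.Icc (0 : ℝ) 1, geodesic p q t ∈ C

/-- The convexity radius: `∞` if `κ ≤ 0`, and `π / (2 √κ)` (the radius of an open hemisphere)
if `0 < κ`. -/
def convexityRadius (κ : ℝ) : ℝ≥0∞ :=
  if 0 < κ then ENNReal.ofReal (Real.pi / (2 * √κ)) else ⊤

/-- The metric projection of `x` onto `C`: the set of all points of `C` nearest to `x`. -/
def metricProjection (C : Set (ModelSpace κ d)) (x : ModelSpace κ d) : Set (ModelSpace κ d) :=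
  {p | p ∈ C ∧ ∀ q ∈ C, dist x p ≤ dist x q}

/-- The geodesic reflection `R_p x = exp_p (-log_p x)` of `x` at the point `p`. -/
def geodesicReflection (p x : ModelSpace κ d) : ModelSpace κ d := exp p (-log p x)

/-- The values of the reflection of `x` at `C`: the geodesic reflections of `x` at the points of
the metric projection of `x` onto `C`. The reflection is well defined at `x` if this set is a
singleton. -/
def reflection (C : Set (ModelSpace κ d)) (x : ModelSpace κ d) : Set (ModelSpace κ d) :=
  (fun p => geodesicReflection p x) '' metricProjection C x

end ModelSpace

end

/-!
For `κ ≠ 0` the reflection at a point is the restriction of a linear map: `R_p x = 2 P x - x`, where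
`P x = ± ⟨p, x⟩ p` with the sign of `κ`. If `p` is a point of `C` nearest to `x`, then `x - P x` is
orthogonal to `p`, and the first variation of the distance along the geodesics from `p` to the
points `c` of the convex set `C` gives `⟨x - P x, c⟩ ≤ 0`
(`form_le_of_mem_metricProjection_of_pos`, `form_le_of_mem_metricProjection_of_neg`). So, for
`κ > 0`, `P` acts like the metric projection onto the convex cone spanned by `C`. With `q` nearest
to `y`, expanding the bilinear form shows
`⟨R_p x, R_q y⟩ - ⟨x, y⟩ = -2 (⟨x - P x, P y⟩ + ⟨P x, y - P y⟩)`.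
The right-hand side is nonnegative because `P x` and `P y` are nonnegative multiples of the points
`p` and `q` of `C`; for `κ > 0` this is where the bound on the distance to `C` enters. Since the
distance is a decreasing function of the form, the reflection is nonexpansive. For `κ = 0` the same
computation works with the variational inequality `⟨x - p, c - p⟩ ≤ 0`.

The nonexpansiveness estimate holds for every choice of nearest points, so `y = x` gives the
independence of that choice. Nearest points exist because the model space is proper: its closed
balls are closed and bounded in the ambient space.
-/

namespace ModelSpace

variable {κ : ℝ} {d : ℕ}

theorem dist_of_pos (hκ : 0 < κ) (x y : ModelSpace κ d) :
    dist x y = 1 / √κ * Real.arccos (form κ x.1 y.1) := by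
  change modelDist x y = _
  rw [modelDist, if_pos hκ]

theorem dist_of_neg (hκ : κ < 0) (x y : ModelSpace κ d) :
    dist x y = 1 / √(-κ) * Real.arcosh (-form κ x.1 y.1) := by
  change modelDist x y = _
  rw [modelDist, if_neg hκ.le.not_gt, if_pos hκ]

theorem dist_of_zero (x y : ModelSpace 0 d) : dist x y = dist x.1.1 y.1.1 := by
  change modelDist x y = _
  rw [modelDist, if_neg (lt_irrefl _), if_neg (lt_irrefl _)]

theorem snd_of_zero (x : ModelSpace 0 d) : x.1.2 = 0 := by
  have h := x.2
  rwa [IsPoint, if_neg (lt_irrefl _), if_neg (lt_irrefl _)] at h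

theorem abs_form_le_one (hκ : 0 < κ) (x y : ModelSpace κ d) : |form κ x.1 y.1| ≤ 1 := by
  have nonneg : ∀ v : Ambient d, 0 ≤ form κ v v := fun v => by
    rw [form, if_neg hκ.le.not_gt, real_inner_self_eq_norm_sq, one_mul]
    exact add_nonneg (sq_nonneg _) (mul_self_nonneg _)
  have h1 := nonneg (x.1 - y.1)
  have h2 := nonneg (x.1 + y.1)
  simp only [form_sub_left, form_sub_right, form_add_left, form_add_right,
    form_self_of_pos hκ, form_comm κ y.1 x.1] at h1 h2
  exact abs_le.mpr ⟨by linarith, by linarith⟩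

theorem dist_le_dist_iff_of_pos (hκ : 0 < κ) (x y z w : ModelSpace κ d) :
    dist x y ≤ dist z w ↔ form κ z.1 w.1 ≤ form κ x.1 y.1 := by
  have h1 := abs_le.mp (abs_form_le_one hκ x y)
  have h2 := abs_le.mp (abs_form_le_one hκ z w)
  rw [dist_of_pos hκ, dist_of_pos hκ, mul_le_mul_iff_right₀ (by positivity)]
  exact Real.strictAntiOn_arccos.le_iff_ge h1 h2

theorem dist_le_dist_iff_of_neg (hκ : κ < 0) (x y z w : ModelSpace κ d) :
    dist x y ≤ dist z w ↔ form κ z.1 w.1 ≤ form κ x.1 y.1 := by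
  have h1 := one_le_neg_form_of_neg hκ x y
  have h2 := one_le_neg_form_of_neg hκ z w
  have : 0 < -κ := by linarith
  rw [dist_of_neg hκ, dist_of_neg hκ, mul_le_mul_iff_right₀ (by positivity),
    Real.arcosh_le_arcosh (by linarith) (by linarith), neg_le_neg_iff]

/-! ### Geodesics and geodesic reflections in ambient coordinates -/

theorem coe_exp_smul_log_of_pos (hκ : 0 < κ) (p q : ModelSpace κ d)
    (h₁ : -1 < form κ p.1 q.1) (h₂ : form κ p.1 q.1 < 1) (t : ℝ) :
    (exp p (t • log p q)).1 =
      Real.cos (t * Real.arccos (form κ p.1 q.1)) • p.1 +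
        (Real.sin (t * Real.arccos (form κ p.1 q.1)) / √(1 - form κ p.1 q.1 ^ 2)) •
          (q.1 - form κ p.1 q.1 • p.1) := by
  set c := form κ p.1 q.1 with hc
  set θ := Real.arccos c
  have hθ : 0 < θ := Real.arccos_pos.mpr h₂
  have hs : 0 < 1 - c ^ 2 := by nlinarith
  have hs' : √(1 - c ^ 2) ^ 2 = 1 - c ^ 2 := Real.sq_sqrt hs.le
  have hs0 : 0 < √(1 - c ^ 2) := Real.sqrt_pos.mpr hs
  have hv : (t • log p q).1 = (t * (θ / √(1 - c ^ 2))) • (q.1 - c • p.1) := by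
    change t • logAmbient p q = _
    rw [logAmbient, if_pos hκ, smul_smul]
  have hn : tangentNorm (t • log p q) = |t * θ| := by
    rw [tangentNorm, hv, ← Real.sqrt_sq_eq_abs]
    congr 1
    simp only [form_smul_left, form_smul_right, form_sub_left, form_sub_right,
      form_self_of_pos hκ, form_comm κ q.1 p.1, ← hc]
    field_simp
    rw [hs']
    ring
  change expAmbient p (t • log p q) = _
  rw [expAmbient, if_pos hκ, hn, hv, Real.cos_abs, smul_smul]
  congr 2
  rcases eq_or_ne t 0 with rfl | ht
  · simp
  have ht' : t * θ ≠ 0 := mul_ne_zero ht hθ.ne'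
  have hdiv : Real.sin |t * θ| / |t * θ| = Real.sin (t * θ) / (t * θ) := by
    rcases abs_choice (t * θ) with h | h <;> rw [h]
    rw [Real.sin_neg, neg_div_neg_eq]
  rw [hdiv]
  field_simp

theorem coe_exp_smul_log_of_neg (hκ : κ < 0) (p q : ModelSpace κ d)
    (h : 1 < -form κ p.1 q.1) (t : ℝ) :
    (exp p (t • log p q)).1 =
      Real.cosh (t * Real.arcosh (-form κ p.1 q.1)) • p.1 +
        (Real.sinh (t * Real.arcosh (-form κ p.1 q.1)) / √(form κ p.1 q.1 ^ 2 - 1)) •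
          (q.1 + form κ p.1 q.1 • p.1) := by
  set c := form κ p.1 q.1 with hc
  set θ := Real.arcosh (-c)
  have hθ : 0 < θ := Real.arcosh_pos h
  have hs : 0 < c ^ 2 - 1 := by nlinarith
  have hs' : √(c ^ 2 - 1) ^ 2 = c ^ 2 - 1 := Real.sq_sqrt hs.le
  have hs0 : 0 < √(c ^ 2 - 1) := Real.sqrt_pos.mpr hs
  have hv : (t • log p q).1 = (t * (θ / √(c ^ 2 - 1))) • (q.1 + c • p.1) := by
    change t • logAmbient p q = _
    rw [logAmbient, if_neg hκ.le.not_gt, if_pos hκ, smul_smul]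
  have hn : tangentNorm (t • log p q) = |t * θ| := by
    rw [tangentNorm, hv, ← Real.sqrt_sq_eq_abs]
    congr 1
    simp only [form_smul_left, form_smul_right, form_add_left, form_add_right,
      form_self_of_neg hκ, form_comm κ q.1 p.1, ← hc]
    field_simp
    rw [hs']
    ring
  change expAmbient p (t • log p q) = _
  rw [expAmbient, if_neg hκ.le.not_gt, if_pos hκ, hn, hv, Real.cosh_abs, smul_smul]
  congr 2
  rcases eq_or_ne t 0 with rfl | ht
  · simp
  have ht' : t * θ ≠ 0 := mul_ne_zero ht hθ.ne'
  have hdiv : Real.sinh |t * θ| / |t * θ| = Real.sinh (t * θ) / (t * θ) := by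
    rcases abs_choice (t * θ) with h | h <;> rw [h]
    rw [Real.sinh_neg, neg_div_neg_eq]
  rw [hdiv]
  field_simp

theorem coe_exp_smul_log_of_zero (p q : ModelSpace 0 d) (t : ℝ) :
    (exp p (t • log p q)).1 = p.1 + t • (q.1 - p.1) := by
  change expAmbient p (t • log p q) = _
  rw [expAmbient, if_neg (lt_irrefl _), if_neg (lt_irrefl _)]
  change p.1 + t • logAmbient p q = _
  rw [logAmbient, if_neg (lt_irrefl _), if_neg (lt_irrefl _)]

theorem geodesicReflection_eq (p x : ModelSpace κ d) :
    geodesicReflection p x = exp p ((-1 : ℝ) • log p x) := by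
  refine congrArg (exp p) (Subtype.ext ?_)
  change -(log p x).1 = (-1 : ℝ) • (log p x).1
  rw [neg_one_smul]

theorem geodesicReflection_self (p : ModelSpace κ d) : geodesicReflection p p = p := by
  have hlog : log p p = 0 := by
    refine Subtype.ext ?_
    change logAmbient p p = 0
    unfold logAmbient
    split_ifs with h1 h2
    · rw [form_self_of_pos h1, one_smul, sub_self, smul_zero]
    · rw [form_self_of_neg h2, neg_one_smul, add_neg_cancel, smul_zero]
    · exact sub_self _
  refine Subtype.ext ?_
  rw [geodesicReflection, hlog, neg_zero]
  change expAmbient p 0 = p.1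
  have hn : tangentNorm (0 : tangentSpace p) = 0 := by
    rw [tangentNorm, ZeroMemClass.coe_zero, form]; simp
  unfold expAmbient
  rw [hn]
  split_ifs <;> simp

/-- The antipode of `p` has to be excluded: there `log p` returns the junk value `0`. -/
theorem coe_geodesicReflection_of_pos (hκ : 0 < κ) (p x : ModelSpace κ d)
    (h : -1 < form κ p.1 x.1) :
    (geodesicReflection p x).1 = (2 * form κ p.1 x.1) • p.1 - x.1 := by
  rcases lt_or_ge (form κ p.1 x.1) 1 with h1 | h1
  · have hs : 0 < √(1 - form κ p.1 x.1 ^ 2) := Real.sqrt_pos.mpr (by nlinarith)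
    rw [geodesicReflection_eq, coe_exp_smul_log_of_pos hκ p x h h1, neg_one_mul, Real.cos_neg,
      Real.sin_neg, Real.cos_arccos h.le h1.le, Real.sin_arccos, neg_div, div_self hs.ne']
    module
  · obtain rfl := eq_of_form_eq_one hκ p x h1
    rw [geodesicReflection_self, form_self_of_pos hκ]
    module

theorem coe_geodesicReflection_of_neg (hκ : κ < 0) (p x : ModelSpace κ d) :
    (geodesicReflection p x).1 = (-2 * form κ p.1 x.1) • p.1 - x.1 := by
  rcases (one_le_neg_form_of_neg hκ p x).lt_or_eq with h | h
  · have hs : 0 < √(form κ p.1 x.1 ^ 2 - 1) := Real.sqrt_pos.mpr (by nlinarith)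
    rw [geodesicReflection_eq, coe_exp_smul_log_of_neg hκ p x h, neg_one_mul, Real.cosh_neg,
      Real.sinh_neg, Real.cosh_arcosh h.le, Real.sinh_arcosh h.le, neg_sq, neg_div,
      div_self hs.ne']
    module
  · obtain rfl := eq_of_neg_form_eq_one hκ p x h.symm
    rw [geodesicReflection_self, form_self_of_neg hκ]
    module

theorem coe_geodesicReflection_of_zero (p x : ModelSpace 0 d) :
    (geodesicReflection p x).1 = p.1 - (x.1 - p.1) := by
  rw [geodesicReflection_eq, coe_exp_smul_log_of_zero]
  module

/-! ### The first variation inequality at a nearest point -/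

theorem nonpos_of_hasDerivAt_of_le {g : ℝ → ℝ} {m : ℝ} (hg : HasDerivAt g m 0)
    (h : ∀ t ∈ Set.Icc (0 : ℝ) 1, g t ≤ g 0) : m ≤ 0 := by
  have hlim := (hasDerivAt_iff_tendsto_slope.mp hg).mono_left
    (nhdsWithin_mono 0 (fun t (ht : t ∈ Set.Ioi (0 : ℝ)) => ne_of_gt ht))
  refine le_of_tendsto hlim ?_
  filter_upwards [Ioc_mem_nhdsGT (zero_lt_one' ℝ)] with t ht
  rw [slope_def_field, sub_zero]
  exact div_nonpos_of_nonpos_of_nonneg (sub_nonpos.mpr (h t ⟨ht.1.le, ht.2⟩)) ht.1.le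

/-- The inequality `⟨x - P x, c⟩ ≤ 0`, where `P x = ⟨p, x⟩ p`. -/
theorem form_le_of_mem_metricProjection_of_pos (hκ : 0 < κ) {C : Set (ModelSpace κ d)}
    (hC : IsConvex C) {x p c : ModelSpace κ d} (hp : p ∈ metricProjection C x) (hc : c ∈ C) :
    form κ x.1 c.1 ≤ form κ p.1 c.1 * form κ x.1 p.1 := by
  have hb := abs_le.mp (abs_form_le_one hκ p c)
  rcases hb.1.eq_or_lt with h1 | h1
  · -- `c` is the antipode of `p`; the inequality is an equality
    have hz : c.1 = -p.1 := by
      have hneg : IsPoint κ (-p.1) := by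
        rw [IsPoint, if_pos hκ, ← neg_one_smul ℝ, form_smul_left, form_smul_right,
          form_self_of_pos hκ]
        norm_num
      have := eq_of_form_eq_one hκ c ⟨-p.1, hneg⟩ (by
        change 1 ≤ form κ c.1 (-p.1)
        rw [← neg_one_smul ℝ, form_smul_right, form_comm, ← h1]
        norm_num)
      exact congrArg Subtype.val this
    rw [← h1, hz, ← neg_one_smul ℝ, form_smul_right]
  rcases hb.2.eq_or_lt with h2 | h2
  · obtain rfl := eq_of_form_eq_one hκ p c h2.ge
    rw [h2, one_mul]
  set b := form κ p.1 c.1 with hbdef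
  set θ := Real.arccos b with hθdef
  have hθ : 0 < θ := Real.arccos_pos.mpr h2
  have hs : 0 < √(1 - b ^ 2) := Real.sqrt_pos.mpr (by nlinarith)
  have hd : dist p c < Real.pi / √κ := by
    rw [dist_of_pos hκ, ← hbdef, div_mul_eq_mul_div, one_mul]
    have : Real.arccos b < Real.pi := by
      refine lt_of_le_of_ne (Real.arccos_le_pi b) fun h => ?_
      exact absurd (Real.arccos_eq_pi.mp h) (not_le.mpr h1)
    gcongr
  let g : ℝ → ℝ := fun t => Real.cos (t * θ) * form κ x.1 p.1 +
    Real.sin (t * θ) / √(1 - b ^ 2) * (form κ x.1 c.1 - b * form κ x.1 p.1)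
  have hle : ∀ t ∈ Set.Icc (0 : ℝ) 1, g t ≤ g 0 := fun t ht => by
    have h := (dist_le_dist_iff_of_pos hκ _ _ _ _).mp (hp.2 _ (hC p hp.1 c hc (fun _ => hd) t ht))
    rw [geodesic, coe_exp_smul_log_of_pos hκ p c h1 h2, form_add_right, form_smul_right,
      form_smul_right, form_sub_right, form_smul_right] at h
    simpa [g] using h
  have hmul : HasDerivAt (fun t : ℝ => t * θ) θ 0 := by
    simpa using (hasDerivAt_id (0 : ℝ)).mul_const θ
  have hder := (hmul.cos.mul_const (form κ x.1 p.1)).add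
    ((hmul.sin.div_const √(1 - b ^ 2)).mul_const (form κ x.1 c.1 - b * form κ x.1 p.1))
  have hm := nonpos_of_hasDerivAt_of_le (g := g) hder hle
  simp only [zero_mul, Real.sin_zero, Real.cos_zero, neg_zero, zero_add, one_mul] at hm
  have := nonpos_of_mul_nonpos_right hm (div_pos hθ hs)
  linarith

/-- The inequality `⟨x - P x, c⟩ ≤ 0`, where `P x = -⟨p, x⟩ p`. -/
theorem form_le_of_mem_metricProjection_of_neg (hκ : κ < 0) {C : Set (ModelSpace κ d)}
    (hC : IsConvex C) {x p c : ModelSpace κ d} (hp : p ∈ metricProjection C x) (hc : c ∈ C) :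
    form κ x.1 c.1 ≤ -(form κ p.1 c.1 * form κ x.1 p.1) := by
  rcases (one_le_neg_form_of_neg hκ p c).lt_or_eq with h1 | h1
  swap
  · obtain rfl := eq_of_neg_form_eq_one hκ p c h1.symm
    rw [← neg_mul, ← h1, one_mul]
  set b := form κ p.1 c.1 with hbdef
  set θ := Real.arcosh (-b) with hθdef
  have hθ : 0 < θ := Real.arcosh_pos h1
  have hs : 0 < √(b ^ 2 - 1) := Real.sqrt_pos.mpr (by nlinarith)
  let g : ℝ → ℝ := fun t => Real.cosh (t * θ) * form κ x.1 p.1 +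
    Real.sinh (t * θ) / √(b ^ 2 - 1) * (form κ x.1 c.1 + b * form κ x.1 p.1)
  have hle : ∀ t ∈ Set.Icc (0 : ℝ) 1, g t ≤ g 0 := fun t ht => by
    have h := (dist_le_dist_iff_of_neg hκ _ _ _ _).mp
      (hp.2 _ (hC p hp.1 c hc (fun h => absurd h hκ.le.not_gt) t ht))
    rw [geodesic, coe_exp_smul_log_of_neg hκ p c h1, form_add_right, form_smul_right,
      form_smul_right, form_add_right, form_smul_right] at h
    simpa [g] using h
  have hmul : HasDerivAt (fun t : ℝ => t * θ) θ 0 := by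
    simpa using (hasDerivAt_id (0 : ℝ)).mul_const θ
  have hder := (hmul.cosh.mul_const (form κ x.1 p.1)).add
    ((hmul.sinh.div_const √(b ^ 2 - 1)).mul_const (form κ x.1 c.1 + b * form κ x.1 p.1))
  have hm := nonpos_of_hasDerivAt_of_le (g := g) hder hle
  simp only [zero_mul, Real.sinh_zero, Real.cosh_zero, zero_add, one_mul] at hm
  have := nonpos_of_mul_nonpos_right hm (div_pos hθ hs)
  linarith

theorem inner_nonpos_of_mem_metricProjection_of_zero {C : Set (ModelSpace 0 d)}
    (hC : IsConvex C) {x p c : ModelSpace 0 d} (hp : p ∈ metricProjection C x) (hc : c ∈ C) :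
    inner ℝ (x.1.1 - p.1.1) (c.1.1 - p.1.1) ≤ 0 := by
  set u := x.1.1 - p.1.1 with hu
  set w := c.1.1 - p.1.1 with hw
  let g : ℝ → ℝ := fun t => 2 * t * inner ℝ u w - t ^ 2 * ‖w‖ ^ 2
  have hle : ∀ t ∈ Set.Icc (0 : ℝ) 1, g t ≤ g 0 := fun t ht => by
    have h := hp.2 _ (hC p hp.1 c hc (fun h => absurd h (lt_irrefl _)) t ht)
    rw [geodesic, dist_of_zero, dist_of_zero, coe_exp_smul_log_of_zero, dist_eq_norm, dist_eq_norm,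
      Prod.fst_add, Prod.smul_fst, Prod.fst_sub, ← sub_sub, ← hu, ← hw] at h
    have h2 := pow_le_pow_left₀ (norm_nonneg _) h 2
    rw [norm_sub_sq_real u, real_inner_smul_right, norm_smul, mul_pow, Real.norm_eq_abs,
      sq_abs] at h2
    simp only [g]
    linarith
  have hder : HasDerivAt g (2 * inner ℝ u w) 0 := by
    have h1 := ((hasDerivAt_id (0 : ℝ)).const_mul 2).mul_const (inner ℝ u w)
    have h2 := ((hasDerivAt_id (0 : ℝ)).pow 2).mul_const (‖w‖ ^ 2)
    have h3 : HasDerivAt g _ 0 := h1.sub h2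
    simpa using h3
  linarith [nonpos_of_hasDerivAt_of_le hder hle]

/-! ### Nonexpansiveness -/

theorem dist_geodesicReflection_le_of_pos (hκ : 0 < κ) {C : Set (ModelSpace κ d)}
    (hC : IsConvex C) {x y p q : ModelSpace κ d}
    (hp : p ∈ metricProjection C x) (hq : q ∈ metricProjection C y)
    (hx : 0 ≤ form κ x.1 p.1) (hy : 0 ≤ form κ y.1 q.1) :
    dist (geodesicReflection p x) (geodesicReflection q y) ≤ dist x y := by
  have h1 := mul_le_mul_of_nonneg_left
    (form_le_of_mem_metricProjection_of_pos hκ hC hp hq.1) hy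
  have h2 := mul_le_mul_of_nonneg_left
    (form_le_of_mem_metricProjection_of_pos hκ hC hq hp.1) hx
  rw [form_comm κ x.1 p.1] at hx
  rw [form_comm κ y.1 q.1] at hy
  rw [dist_le_dist_iff_of_pos hκ, coe_geodesicReflection_of_pos hκ p x (by linarith),
    coe_geodesicReflection_of_pos hκ q y (by linarith)]
  simp only [form_sub_left, form_sub_right, form_smul_left, form_smul_right]
  rw [form_comm κ p.1 y.1, form_comm κ p.1 x.1, form_comm κ q.1 y.1]
  rw [form_comm κ q.1 p.1] at h2
  linarith

theorem dist_geodesicReflection_le_of_neg (hκ : κ < 0) {C : Set (ModelSpace κ d)}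
    (hC : IsConvex C) {x y p q : ModelSpace κ d}
    (hp : p ∈ metricProjection C x) (hq : q ∈ metricProjection C y) :
    dist (geodesicReflection p x) (geodesicReflection q y) ≤ dist x y := by
  have h1 := mul_le_mul_of_nonneg_left
    (form_le_of_mem_metricProjection_of_neg hκ hC hp hq.1)
    (zero_le_one.trans (one_le_neg_form_of_neg hκ y q))
  have h2 := mul_le_mul_of_nonneg_left
    (form_le_of_mem_metricProjection_of_neg hκ hC hq hp.1)
    (zero_le_one.trans (one_le_neg_form_of_neg hκ x p))
  rw [dist_le_dist_iff_of_neg hκ, coe_geodesicReflection_of_neg hκ,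
    coe_geodesicReflection_of_neg hκ]
  simp only [form_sub_left, form_sub_right, form_smul_left, form_smul_right]
  rw [form_comm κ p.1 y.1, form_comm κ p.1 x.1, form_comm κ q.1 y.1]
  rw [form_comm κ q.1 p.1] at h2
  linarith

theorem dist_geodesicReflection_le_of_zero {C : Set (ModelSpace 0 d)}
    (hC : IsConvex C) {x y p q : ModelSpace 0 d}
    (hp : p ∈ metricProjection C x) (hq : q ∈ metricProjection C y) :
    dist (geodesicReflection p x) (geodesicReflection q y) ≤ dist x y := by
  have h1 := inner_nonpos_of_mem_metricProjection_of_zero hC hp hq.1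
  have h2 := inner_nonpos_of_mem_metricProjection_of_zero hC hq hp.1
  rw [dist_of_zero, dist_of_zero, coe_geodesicReflection_of_zero, coe_geodesicReflection_of_zero,
    dist_eq_norm, dist_eq_norm]
  refine le_of_sq_le_sq ?_ (norm_nonneg _)
  simp only [Prod.fst_sub]
  set u := x.1.1 - p.1.1
  set v := y.1.1 - q.1.1
  have e1 : p.1.1 - u - (q.1.1 - v) = (p.1.1 - q.1.1) - (u - v) := by abel
  have e2 : x.1.1 - y.1.1 = (p.1.1 - q.1.1) + (u - v) := by simp only [u, v]; abel
  rw [e1, e2, norm_sub_sq_real, norm_add_sq_real, inner_sub_right, real_inner_comm u,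
    real_inner_comm v]
  rw [← neg_sub p.1.1, inner_neg_right] at h1
  linarith

/-- Two points at distance at most a quarter of a great circle have nonnegative inner product. -/
theorem form_nonneg_of_dist_le (hκ : 0 < κ) {x p : ModelSpace κ d}
    (h : dist x p ≤ Real.pi / (2 * √κ)) : 0 ≤ form κ x.1 p.1 := by
  have hk : 0 < √κ := Real.sqrt_pos.mpr hκ
  rw [dist_of_pos hκ, ← div_div, div_mul_eq_mul_div, one_mul,
    div_le_div_iff_of_pos_right hk] at h
  exact Real.arccos_le_pi_div_two.mp h

theorem dist_geodesicReflection_le {C : Set (ModelSpace κ d)} (hC : IsConvex C)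
    {x y p q : ModelSpace κ d}
    (hx : Metric.infEDist x C ≤ convexityRadius κ) (hy : Metric.infEDist y C ≤ convexityRadius κ)
    (hp : p ∈ metricProjection C x) (hq : q ∈ metricProjection C y) :
    dist (geodesicReflection p x) (geodesicReflection q y) ≤ dist x y := by
  rcases lt_trichotomy κ 0 with hκ | rfl | hκ
  · exact dist_geodesicReflection_le_of_neg hκ hC hp hq
  · exact dist_geodesicReflection_le_of_zero hC hp hq
  · have key : ∀ {z r : ModelSpace κ d}, Metric.infEDist z C ≤ convexityRadius κ →
        r ∈ metricProjection C z → 0 ≤ form κ z.1 r.1 := fun {z r} hz hr => by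
      refine form_nonneg_of_dist_le hκ ?_
      have h1 : edist z r ≤ Metric.infEDist z C := Metric.le_infEDist.mpr fun c hc => by
        rw [edist_dist, edist_dist]
        exact ENNReal.ofReal_le_ofReal (hr.2 c hc)
      have h2 := h1.trans hz
      rw [convexityRadius, if_pos hκ, edist_dist] at h2
      exact (ENNReal.ofReal_le_ofReal_iff (by positivity)).mp h2
    exact dist_geodesicReflection_le_of_pos hκ hC hp hq (key hx hp) (key hy hq)

/-! ### Existence of nearest points -/

theorem continuous_form : Continuous fun z : Ambient d × Ambient d => form κ z.1 z.2 := by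
  unfold form
  fun_prop

/-- The identity from the points, with the topology of the ambient space, to the model space,
with the topology of its metric. -/
def ofAmbient (a : {a : Ambient d // IsPoint κ a}) : ModelSpace κ d := a

theorem continuous_ofAmbient : Continuous (ofAmbient (κ := κ) (d := d)) := by
  refine continuous_iff_continuousAt.mpr fun b => tendsto_iff_dist_tendsto_zero.mpr ?_
  have hform : Continuous fun a : {a : Ambient d // IsPoint κ a} => form κ a.1 b.1 :=
    continuous_form.comp (continuous_subtype_val.prodMk continuous_const)
  rw [← dist_self (ofAmbient b)]
  rcases lt_trichotomy κ 0 with hκ | rfl | hκ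
  · simp only [dist_of_neg hκ]
    refine Filter.Tendsto.const_mul (1 / √(-κ)) ?_
    have h1 : ContinuousWithinAt Real.arcosh (Set.Ici 1)
        (-form κ (ofAmbient b).1 (ofAmbient b).1) :=
      Real.continuousOn_arcosh _ (one_le_neg_form_of_neg hκ (ofAmbient b) (ofAmbient b))
    exact h1.tendsto.comp (tendsto_nhdsWithin_iff.mpr ⟨hform.neg.continuousAt,
      Filter.Eventually.of_forall fun a => one_le_neg_form_of_neg hκ (ofAmbient a) (ofAmbient b)⟩)
  · simp only [dist_of_zero]
    have h : Continuous fun a : {a : Ambient d // IsPoint 0 a} => dist a.1.1 b.1.1 := by fun_prop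
    exact h.tendsto b
  · simp only [dist_of_pos hκ]
    exact ((Real.continuous_arccos.comp hform).tendsto b).const_mul (1 / √κ)

theorem isClosed_setOf_isPoint : IsClosed {a : Ambient d | IsPoint κ a} := by
  have hf : Continuous fun a : Ambient d => form κ a a :=
    continuous_form.comp (continuous_id.prodMk continuous_id)
  rcases lt_trichotomy κ 0 with hκ | rfl | hκ
  · have : {a : Ambient d | IsPoint κ a} = {a | form κ a a = -1} ∩ {a | 0 ≤ a.2} := by
      ext a
      simp only [IsPoint, if_neg hκ.le.not_gt, if_pos hκ, Set.mem_ofPred_eq, Set.mem_inter_iff]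
      refine and_congr_right fun h => ⟨le_of_lt, fun h2 => lt_of_le_of_ne h2 fun h3 => ?_⟩
      rw [form, ← h3, real_inner_self_eq_norm_sq] at h
      nlinarith [sq_nonneg ‖a.1‖]
    rw [this]
    exact (isClosed_eq hf continuous_const).inter (isClosed_le continuous_const continuous_snd)
  · simp only [IsPoint, lt_irrefl, if_false]
    exact isClosed_eq continuous_snd continuous_const
  · simp only [IsPoint, if_pos hκ]
    exact isClosed_eq hf continuous_const

theorem exists_norm_le_of_dist_le (x : ModelSpace κ d) (r : ℝ) :
    ∃ R : ℝ, ∀ a : ModelSpace κ d, dist x a ≤ r → ‖a.1‖ ≤ R := by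
  rcases lt_trichotomy κ 0 with hκ | rfl | hκ
  · have hk : 0 < √(-κ) := Real.sqrt_pos.mpr (by linarith)
    have hfst_le : ∀ a : ModelSpace κ d, ‖a.1.1‖ < a.1.2 := fun a => by
      have h := form_self_of_neg hκ a
      have h2 := snd_pos_of_neg hκ a
      rw [form, if_pos hκ, real_inner_self_eq_norm_sq] at h
      exact lt_of_pow_lt_pow_left₀ 2 h2.le (by nlinarith)
    have hx := hfst_le x
    refine ⟨Real.cosh (√(-κ) * r) / (x.1.2 - ‖x.1.1‖), fun a ha => ?_⟩
    have haf := hfst_le a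
    have hsnd : a.1.2 ≤ Real.cosh (√(-κ) * r) / (x.1.2 - ‖x.1.1‖) := by
      rw [dist_of_neg hκ, div_mul_eq_mul_div, one_mul, div_le_iff₀' hk] at ha
      have h1 := one_le_neg_form_of_neg hκ x a
      have h0 := Real.arcosh_nonneg h1
      have h2 : -form κ x.1 a.1 ≤ Real.cosh (√(-κ) * r) := by
        rw [← Real.cosh_arcosh h1, Real.cosh_le_cosh, abs_of_nonneg h0]
        exact ha.trans (le_abs_self _)
      rw [form, if_pos hκ] at h2
      have h3 := real_inner_le_norm x.1.1 a.1.1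
      rw [le_div_iff₀ (by linarith)]
      nlinarith [mul_le_mul_of_nonneg_left haf.le (norm_nonneg x.1.1)]
    rw [Prod.norm_def, Real.norm_eq_abs, abs_of_pos (snd_pos_of_neg hκ a)]
    exact max_le (haf.le.trans hsnd) hsnd
  · refine ⟨‖x.1.1‖ + r, fun a ha => ?_⟩
    rw [dist_of_zero] at ha
    have h0 : 0 ≤ r := dist_nonneg.trans ha
    rw [Prod.norm_def, snd_of_zero a, norm_zero, max_eq_left (norm_nonneg _)]
    rw [dist_comm, dist_eq_norm] at ha
    linarith [norm_le_norm_add_norm_sub' a.1.1 x.1.1]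
  · refine ⟨1, fun a _ => ?_⟩
    have h := form_self_of_pos hκ a
    rw [form, if_neg hκ.le.not_gt, real_inner_self_eq_norm_sq] at h
    rw [Prod.norm_def, Real.norm_eq_abs]
    refine max_le ?_ (abs_le_one_iff_mul_self_le_one.mpr (by nlinarith [sq_nonneg ‖a.1.1‖]))
    nlinarith [mul_self_nonneg a.1.2, norm_nonneg a.1.1]

instance : ProperSpace (ModelSpace κ d) where
  isCompact_closedBall x r := by
    obtain ⟨R, hR⟩ := exists_norm_le_of_dist_le x r
    have hK : IsCompact ((fun a : {a : Ambient d // IsPoint κ a} => (a : Ambient d)) ⁻¹'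
        Metric.closedBall 0 R) :=
      isClosed_setOf_isPoint.isClosedEmbedding_subtypeVal.isCompact_preimage
        (isCompact_closedBall 0 R)
    refine (hK.image continuous_ofAmbient).of_isClosed_subset Metric.isClosed_closedBall fun a ha => ?_
    refine ⟨a, ?_, rfl⟩
    rw [Metric.mem_closedBall, dist_comm] at ha
    exact mem_closedBall_zero_iff.mpr (hR a ha)

theorem metricProjection_nonempty {C : Set (ModelSpace κ d)} (hne : C.Nonempty)
    (hcl : IsClosed C) (x : ModelSpace κ d) : (metricProjection C x).Nonempty := by
  obtain ⟨p, hp, h⟩ := hcl.exists_infDist_eq_dist hne x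
  exact ⟨p, hp, fun q hq => h ▸ Metric.infDist_le_dist_of_mem hq⟩

/-- The nonexpansiveness estimate with `y = x` shows that the reflection does not depend on the
choice of the nearest point. -/
theorem reflection_eq_singleton {C : Set (ModelSpace κ d)} (hC : IsConvex C)
    {x p : ModelSpace κ d} (hx : Metric.infEDist x C ≤ convexityRadius κ)
    (hp : p ∈ metricProjection C x) : reflection C x = {geodesicReflection p x} := by
  refine Set.eq_singleton_iff_unique_mem.mpr ⟨⟨p, hp, rfl⟩, ?_⟩
  rintro _ ⟨q, hq, rfl⟩
  have h := dist_geodesicReflection_le hC hx hx hq hp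
  rw [dist_self] at h
  exact dist_le_zero.mp h

end ModelSpace

theorem theorem6p2 (κ : ℝ) (d : ℕ) (C : Set (ModelSpace κ d))
    (hC_nonempty : C.Nonempty) (hC_closed : IsClosed C) (hC_convex : ModelSpace.IsConvex C)
    (x y : ModelSpace κ d)
    (hx : Metric.infEDist x C ≤ ModelSpace.convexityRadius κ)
    (hy : Metric.infEDist y C ≤ ModelSpace.convexityRadius κ) :
    ∃ x' y' : ModelSpace κ d,
      ModelSpace.reflection C x = {x'} ∧ ModelSpace.reflection C y = {y'} ∧
        dist x' y' ≤ dist x y := by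
  obtain ⟨p, hp⟩ := ModelSpace.metricProjection_nonempty hC_nonempty hC_closed x
  obtain ⟨q, hq⟩ := ModelSpace.metricProjection_nonempty hC_nonempty hC_closed y
  exact ⟨_, _, ModelSpace.reflection_eq_singleton hC_convex hx hp,
    ModelSpace.reflection_eq_singleton hC_convex hy hq,
    ModelSpace.dist_geodesicReflection_le hC_convex hx hy hp hq⟩
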